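/- A sign pattern of order $n$ is an $n\times n$ matrix $\mathcal{A}$ with entries in $\{+,-,0\}$; its qualitative class $Q(\mathcal{A})$ is the set of real $n\times n$ matrices $A$ such that, for all $i,j$, $A_{ij}>0$ if $\mathcal{A}_{ij}=+$, $A_{ij}<0$ if $\mathcal{A}_{ij}=-$, and $A_{ij}=0$ if $\mathcal{A}_{ij}=0$. A real $n\times n$ matrix $A$ has the \emph{non-symmetric strong multiplicity property} (nSMP) if $X=0$ is the only real $n\times n$ matrix $X$ with $A\circ X=0$ (entrywise product), $AX^T-X^TA=0$, and $\operatorname{tr}(X^TA^k)=0$ for all $0\le k<n$. The pattern $\mathcal{A}$ \emph{allows} the nSMP if some $A\in Q(\mathcal{A})$ has the nSMP. The digraph $D(\mathcal{A})$ has vertices $1,\dots,n$ and an arc (a loop if $i=j$) from $i$ to $j$ exactly when $\mathcal{A}_{ij}\ne 0$. A composite cycle of length $k$ in $D(\mathcal{A})$ is a (possibly empty) collection of pairwise vertex-disjoint simple directed cycles (loops included) on exactly $k$ vertices in total. \textbf{Corollary.} An $n\times n$ sign pattern $\mathcal{A}$ allows the nSMP if and only if the largest length of a composite cycle in $D(\mathcal{A})$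 is at least $n-1$. -/

import Mathlib

/-- An `n × n` sign pattern: a matrix with entries in `{+, -, 0}`. -/
abbrev SignPattern (n : ℕ) : Type := Matrix (Fin n) (Fin n) SignType

namespace SignPattern

/-- The qualitative class `Q(𝒜)`: the real matrices whose entries have the signs given by `𝒜`. -/
def qualitativeClass {n : ℕ} (𝒜 : SignPattern n) : Set (Matrix (Fin n) (Fin n) ℝ) :=
  {A | ∀ i j, SignType.sign (A i j) = 𝒜 i j}

/-- `𝒜` allows the matrix property `P` if some realization of `𝒜` has it. -/
def Allows {n : ℕ} (𝒜 : SignPattern n) (P : Matrix (Fin n) (Fin n) ℝ → Prop) : Prop :=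
  ∃ A ∈ 𝒜.qualitativeClass, P A

/-- The digraph `D(𝒜)` (loops allowed): an arc from `i` to `j` whenever `𝒜 i j ≠ 0`. The sign of
that arc is `𝒜 i j`; signs play no role for the length of a cycle. -/
def digraph {n : ℕ} (𝒜 : SignPattern n) : Digraph (Fin n) where
  Adj i j := 𝒜 i j ≠ 0

end SignPattern

/-- The non-symmetric strong multiplicity property of a real square matrix. -/
def HasNSMP {n : ℕ} (A : Matrix (Fin n) (Fin n) ℝ) : Prop :=
  ∀ X : Matrix (Fin n) (Fin n) ℝ,
    Matrix.hadamard A X = 0 →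
    A * X.transpose - X.transpose * A = 0 →
    (∀ k : ℕ, k < n → (X.transpose * A ^ k).trace = 0) →
    X = 0

namespace Digraph

/-- A (simple, directed) cycle of a digraph: a nonempty cyclic sequence of distinct vertices
`v₁, …, v_k` with arcs `v₁ → v₂ → ⋯ → v_k → v₁`; for `k = 1` this is a loop. -/
def IsSimpleCycle {V : Type*} (D : Digraph V) (c : Cycle V) : Prop :=
  c ≠ Cycle.nil ∧ c.Nodup ∧ c.Chain D.Adj

/-- A composite cycle of length `k`: a (finite, possibly empty) collection of pairwise
vertex-disjoint simple cycles that cover exactly `k` vertices in total. -/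
def HasCompositeCycle {V : Type*} [DecidableEq V] (D : Digraph V) (k : ℕ) : Prop :=
  ∃ C : Finset (Cycle V),
    (∀ c ∈ C, D.IsSimpleCycle c) ∧
    (C : Set (Cycle V)).PairwiseDisjoint Cycle.toFinset ∧
    (C.biUnion Cycle.toFinset).card = k

/-- The length of a largest composite cycle. -/
noncomputable def maxCompositeCycleLength {V : Type*} [DecidableEq V] (D : Digraph V) : ℕ :=
  sSup {k | D.HasCompositeCycle k}

/-- In a finite digraph the maximum is attained (it is `0` if there is no cycle). -/
theorem isGreatest_maxCompositeCycleLength {V : Type*} [DecidableEq V] [Fintype V]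
    (D : Digraph V) :
    IsGreatest {k | D.HasCompositeCycle k} D.maxCompositeCycleLength := by
  have hb : BddAbove {k | D.HasCompositeCycle k} := by
    refine ⟨Fintype.card V, ?_⟩
    rintro k ⟨C, -, -, rfl⟩
    exact Finset.card_le_univ _
  have hne : {k | D.HasCompositeCycle k}.Nonempty := ⟨0, ∅, by simp, by simp, by simp⟩
  exact ⟨Nat.sSup_mem hne hb, fun k hk => le_csSup hb hk⟩

end Digraph

/-!
Both sides of the equivalence are compared with the existence of a permutation `σ` that follows arcs
of the digraph except possibly at one fixed vertex (`Digraph.HasNearCover`); the orbits of `σ` form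
a composite cycle covering all vertices but at most one (`Digraph.hasNearCover_iff`).

A real matrix with distinct complex eigenvalues has the nSMP
(`Matrix.hasNSMP_of_separable_charpoly`): what commutes with it is diagonal in an eigenbasis, and
the trace conditions become a Vandermonde system. Given `σ`, a permutation matrix with suitable
weights on the orbits has distinct eigenvalues. Separability of the characteristic polynomial is
an algebraic condition, so a generic small perturbation of any realization of the pattern towards
that matrix has distinct eigenvalues as well, and still has the right signs.

Conversely, the nSMP of `A` says by duality that a map is a submersion: the one sending a
perturbation of `A` within its zero pattern, a conjugation and a polynomial to the conjugate of the
polynomial evaluated at the perturbation (`HasNSMP.exists_decomposition`,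
`eventually_exists_conj_aeval`). Its image is a neighbourhood of `A`, so it contains matrices with
distinct eigenvalues, and hence some `N`, zero wherever `A` is, does not have `0` as a
multiple eigenvalue. Since `X ^ 2` does not divide the characteristic polynomial of `N`, some term
of its permutation expansion involves at most one zero entry of `N`, and the permutation of that
term is `σ` (`Matrix.exists_perm_of_not_X_sq_dvd_charpoly`).
-/

/-! ### Composite cycles and permutations -/

theorem Cycle.mem_toFinset_iff {V : Type*} [DecidableEq V] {c : Cycle V} {x : V} :
    x ∈ c.toFinset ↔ x ∈ c := by
  induction c using Cycle.induction_on with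
  | nil => simp [Cycle.notMem_nil]
  | cons a l _ => rw [Cycle.coe_toFinset, List.mem_toFinset, Cycle.mem_coe_iff]

namespace Digraph

/-- A permutation of the vertices that follows arcs of `D` except possibly at one vertex, which it
then fixes. Its orbits, without the exceptional fixed point, are a composite cycle missing at most
one vertex; this is the form in which such a composite cycle enters the matrix arguments. -/
def HasNearCover {V : Type*} (D : Digraph V) : Prop :=
  ∃ σ : Equiv.Perm V, (∀ i, D.Adj i (σ i) ∨ σ i = i) ∧
    ∀ i j, ¬ D.Adj i (σ i) → ¬ D.Adj j (σ j) → i = j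

theorem exists_compositeCycle_of_hasNearCover {V : Type*} [Fintype V] [DecidableEq V]
    {D : Digraph V} (h : D.HasNearCover) :
    ∃ k, D.HasCompositeCycle k ∧ Fintype.card V ≤ k + 1 := by
  classical
  obtain ⟨σ, hσ, huniq⟩ := h
  have hper : ∀ x, x ∈ Function.periodicPts σ := fun x => by
    exact Function.Injective.mem_periodicPts σ.injective x
  -- Moving along an orbit never reaches the exceptional vertex: it is a fixed point of `σ`.
  have hgood : ∀ x, D.Adj x (σ x) → ∀ m : ℕ, D.Adj (σ^[m] x) (σ (σ^[m] x)) := by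
    intro x hx m
    rcases hσ (σ^[m] x) with h | h
    · exact h
    · have : σ x = x := by
        apply (σ.injective.iterate m)
        rw [← Function.iterate_succ_apply, Function.iterate_succ_apply', h]
      have h2 : σ^[m] x = x := Function.iterate_fixed this m
      rwa [h2]
  let S : Finset V := Finset.univ.filter fun i => D.Adj i (σ i)
  refine ⟨_, ⟨S.image (Function.periodicOrbit σ), ?_, ?_, rfl⟩, ?_⟩
  · intro c hc
    obtain ⟨x, hx, rfl⟩ := Finset.mem_image.1 hc
    have hx : D.Adj x (σ x) := by simpa [S] using hx
    refine ⟨?_, Function.nodup_periodicOrbit, ?_⟩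
    · rw [Ne, Function.periodicOrbit_eq_nil_iff_not_periodic_pt, not_not]
      exact hper x
    · rw [Function.periodicOrbit_chain' _ (hper x)]
      intro m
      rw [Function.iterate_succ_apply']
      exact hgood x hx m
  · intro c hc d hd hcd
    obtain ⟨x, hx, rfl⟩ := Finset.mem_image.1 (Finset.mem_coe.1 hc)
    obtain ⟨y, hy, rfl⟩ := Finset.mem_image.1 (Finset.mem_coe.1 hd)
    rw [Function.onFun, Finset.disjoint_left]
    intro z hzx hzy
    apply hcd
    have hzx' : z ∈ Function.periodicOrbit σ x := Cycle.mem_toFinset_iff.1 hzx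
    have hzy' : z ∈ Function.periodicOrbit σ y := Cycle.mem_toFinset_iff.1 hzy
    rw [Function.mem_periodicOrbit_iff (hper _)] at hzx' hzy'
    obtain ⟨a, rfl⟩ := hzx'
    obtain ⟨b, hb⟩ := hzy'
    rw [← Function.periodicOrbit_apply_iterate_eq (hper x) a,
      ← Function.periodicOrbit_apply_iterate_eq (hper y) b, hb]
  · have h1 : S ⊆ (S.image (Function.periodicOrbit σ)).biUnion Cycle.toFinset := by
      intro x hx
      refine Finset.mem_biUnion.2 ⟨_, Finset.mem_image_of_mem _ hx, ?_⟩
      exact Cycle.mem_toFinset_iff.2 (Function.self_mem_periodicOrbit (hper x))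
    have h2 : Sᶜ.card ≤ 1 := by
      rw [Finset.card_le_one]
      intro a ha b hb
      exact huniq a b (by simpa [S] using ha) (by simpa [S] using hb)
    have h3 := Finset.card_le_card h1
    have h4 := Finset.card_add_card_compl S
    omega

/-- Each element of a chain cycle is related to its successor, wherever the cycle is cut. -/
theorem adj_next_of_chain {V : Type*} [DecidableEq V] {r : V → V → Prop} {c : Cycle V}
    (hn : c.Nodup) (hc : c.Chain r) {x : V} (hx : x ∈ c) : r x (c.next hn x hx) := by
  induction c using Cycle.induction_on with
  | nil => exact absurd hx (Cycle.notMem_nil x)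
  | cons a l _ =>
    obtain ⟨l', hl'⟩ : ∃ l', ((a :: l : List V) : Cycle V) = ((x :: l' : List V) : Cycle V) := by
      obtain ⟨s, t, hst⟩ := List.append_of_mem (Cycle.mem_coe_iff.1 hx)
      refine ⟨t ++ s, ?_⟩
      rw [hst, Cycle.coe_eq_coe]
      exact List.isRotated_append
    revert hn hc hx
    rw [hl']
    intro hn hc hx
    cases l' with
    | nil =>
      have : Cycle.next _ hn x hx = x := by
        exact List.next_singleton x x (by simp)
      rw [this]
      simpa using hc
    | cons y l' =>
      rw [Cycle.chain_coe_cons] at hc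
      have : Cycle.next _ hn x hx = y := by
        exact List.next_cons_cons_eq l' x y (by simp)
      rw [this]
      simp only [List.cons_append, List.isChain_cons_cons] at hc
      exact hc.1

theorem hasNearCover_of_hasCompositeCycle {V : Type*} [Fintype V] [DecidableEq V]
    {D : Digraph V} {k : ℕ} (h : D.HasCompositeCycle k) (hk : Fintype.card V ≤ k + 1) :
    D.HasNearCover := by
  classical
  obtain ⟨C, hC, hdisj, rfl⟩ := h
  have huniq : ∀ c ∈ C, ∀ d ∈ C, ∀ x, x ∈ c → x ∈ d → c = d := by
    intro c hc d hd x hxc hxd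
    by_contra hne
    have := hdisj (Finset.mem_coe.2 hc) (Finset.mem_coe.2 hd) hne
    rw [Function.onFun, Finset.disjoint_left] at this
    exact this (a := x) (Cycle.mem_toFinset_iff.2 hxc)
      (Cycle.mem_toFinset_iff.2 hxd)
  -- Glue the cyclic permutations of the members of `C`, fixing the uncovered vertices.
  have hex : ∃ f : V → V, (∀ c ∈ C, ∀ hn : c.Nodup, ∀ x ∈ c, f x = c.formPerm hn x) ∧
      ∀ x, (∀ c ∈ C, x ∉ c) → f x = x := by
    choose! g hg using fun (x : V) (h : ∃ c ∈ C, x ∈ c) => h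
    refine ⟨fun x => if h : g x ∈ C then (g x).formPerm (hC _ h).2.1 x else x, ?_, ?_⟩
    · intro c hc hn x hx
      have h1 := hg x ⟨c, hc, hx⟩
      have h2 : g x = c := huniq _ h1.1 _ hc x h1.2 hx
      subst h2
      simp [hc]
    · intro x hx
      dsimp only
      split_ifs with h
      · exact Cycle.formPerm_eq_self_of_notMem _ _ _ (hx _ h)
      · rfl
  obtain ⟨f, hf, hf'⟩ := hex
  have hmem : ∀ c ∈ C, ∀ x ∈ c, f x ∈ c := by
    intro c hc x hx
    rw [hf c hc (hC c hc).2.1 x hx, Cycle.formPerm_apply_mem_eq_next _ _ _ hx]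
    exact Cycle.next_mem _ _ _ _
  have hinj : Function.Injective f := by
    intro x y hxy
    by_cases hx : ∃ c ∈ C, x ∈ c
    · obtain ⟨c, hc, hxc⟩ := hx
      have h1 := hmem c hc x hxc
      rw [hxy] at h1
      have hyc : y ∈ c := by
        by_cases hy : ∃ d ∈ C, y ∈ d
        · obtain ⟨d, hd, hyd⟩ := hy
          rwa [huniq c hc d hd _ h1 (hmem d hd y hyd)]
        · push Not at hy
          rwa [hf' y hy] at h1
      rw [hf c hc (hC c hc).2.1 x hxc, hf c hc (hC c hc).2.1 y hyc] at hxy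
      exact Equiv.injective _ hxy
    · by_cases hy : ∃ c ∈ C, y ∈ c
      · obtain ⟨c, hc, hyc⟩ := hy
        have h1 := hmem c hc y hyc
        push Not at hx
        rw [← hxy, hf' x hx] at h1
        exact absurd h1 (hx c hc)
      · push Not at hx hy
        rwa [hf' x hx, hf' y hy] at hxy
  have hadj : ∀ c ∈ C, ∀ x ∈ c, D.Adj x (f x) := by
    intro c hc x hx
    rw [hf c hc (hC c hc).2.1 x hx, Cycle.formPerm_apply_mem_eq_next _ _ _ hx]
    exact adj_next_of_chain (hC c hc).2.1 (hC c hc).2.2 hx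
  refine ⟨Equiv.ofBijective f (Finite.injective_iff_bijective.1 hinj), ?_, ?_⟩
  · intro x
    by_cases hx : ∃ c ∈ C, x ∈ c
    · obtain ⟨c, hc, hxc⟩ := hx
      exact Or.inl (hadj c hc x hxc)
    · push Not at hx
      exact Or.inr (hf' x hx)
  · have h1 : (C.biUnion Cycle.toFinset)ᶜ.card ≤ 1 := by
      have := Finset.card_add_card_compl (C.biUnion Cycle.toFinset)
      omega
    rw [Finset.card_le_one] at h1
    have h2 : ∀ x, ¬ D.Adj x (f x) → x ∈ (C.biUnion Cycle.toFinset)ᶜ := by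
      intro x hx
      rw [Finset.mem_compl, Finset.mem_biUnion]
      rintro ⟨c, hc, hxc⟩
      exact hx (hadj c hc x (Cycle.mem_toFinset_iff.1 hxc))
    intro i j hi hj
    exact h1 i (h2 i hi) j (h2 j hj)

theorem hasNearCover_iff {n : ℕ} (D : Digraph (Fin n)) :
    D.HasNearCover ↔ (n : ℤ) - 1 ≤ (D.maxCompositeCycleLength : ℤ) := by
  have hg := D.isGreatest_maxCompositeCycleLength
  constructor
  · intro h
    obtain ⟨k, hk, hn⟩ := exists_compositeCycle_of_hasNearCover h
    have := hg.2 hk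
    rw [Fintype.card_fin] at hn
    omega
  · intro h
    exact hasNearCover_of_hasCompositeCycle hg.1 (by rw [Fintype.card_fin]; omega)

end Digraph

section

open Polynomial
open scoped Matrix

/-! ### Characteristic polynomials and distinct eigenvalues -/

namespace Matrix

/-- Expand `det (X - N)` over permutations. A term is zero when the permutation moves some `i`
with `N i (σ i) = 0`, and every fixed point with zero diagonal entry contributes a factor `X`; so
a polynomial not divisible by `X ^ 2` must have a term with at most one vanishing entry. -/
theorem exists_perm_of_not_X_sq_dvd_charpoly {n : Type*} [Fintype n] [DecidableEq n] {R : Type*}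
    [CommRing R] (N : Matrix n n R) (h : ¬ X ^ 2 ∣ N.charpoly) :
    ∃ σ : Equiv.Perm n, (∀ i, N i (σ i) ≠ 0 ∨ σ i = i) ∧
      ∀ i j, N i (σ i) = 0 → N j (σ j) = 0 → i = j := by
  contrapose! h
  rw [← charpoly_transpose, charpoly, det_apply']
  refine Finset.dvd_sum fun σ _ => Dvd.dvd.mul_left ?_ _
  by_cases hz : ∃ i, N i (σ i) = 0 ∧ σ i ≠ i
  · obtain ⟨i, hi, hne⟩ := hz
    rw [Finset.prod_eq_zero (Finset.mem_univ i)]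
    · exact dvd_zero _
    · rw [charmatrix_apply_ne _ _ _ hne, transpose_apply, hi, C_0, neg_zero]
  · push Not at hz
    obtain ⟨i, j, hi, hj, hij⟩ := h σ fun i => by
      by_cases h0 : N i (σ i) = 0
      · exact Or.inr (hz i h0)
      · exact Or.inl h0
    have hX : ∀ l, N l (σ l) = 0 → X ∣ Nᵀ.charmatrix (σ l) l := fun l hl => by
      have h1 := hz l hl
      rw [h1] at hl ⊢
      simp [hl]
    rw [← Finset.mul_prod_erase _ _ (Finset.mem_univ i),
      ← Finset.mul_prod_erase _ _ (Finset.mem_erase.2 ⟨hij.symm, Finset.mem_univ j⟩), ← mul_assoc,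
      sq]
    exact Dvd.dvd.mul_right (mul_dvd_mul (hX i hi) (hX j hj)) _

theorem charpoly_eq_prod_of_eigenvectors {n K : Type*} [Fintype n] [DecidableEq n] [Field K]
    (A : Matrix n n K) {l : n → K} (hl : Function.Injective l)
    (v : n → n → K) (hv : ∀ i, v i ≠ 0) (hAv : ∀ i, A *ᵥ v i = l i • v i) :
    A.charpoly = ∏ i, (X - C (l i)) := by
  have hroot : ∀ i, A.charpoly.IsRoot (l i) := by
    intro i
    rw [IsRoot, eval_charpoly, ← exists_mulVec_eq_zero_iff]
    refine ⟨v i, hv i, ?_⟩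
    rw [sub_mulVec, hAv]
    ext j
    simp [scalar_apply]
  have hdvd : ∏ i, (X - C (l i)) ∣ A.charpoly := by
    refine Finset.prod_dvd_of_coprime ?_ fun i _ => dvd_iff_isRoot.2 (hroot i)
    intro i _ j _ hij
    exact isCoprime_X_sub_C_of_isUnit_sub (sub_ne_zero.2 (hl.ne hij)).isUnit
  refine (eq_of_monic_of_dvd_of_natDegree_le (monic_prod_X_sub_C _ _) A.charpoly_monic hdvd
    ?_)
  rw [charpoly_natDegree_eq_dim, natDegree_prod_of_monic _ _ fun i _ => monic_X_sub_C _]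
  simp

theorem separable_charpoly_of_eigenvectors {n K : Type*} [Fintype n] [DecidableEq n] [Field K]
    (A : Matrix n n K) {l : n → K} (hl : Function.Injective l)
    (v : n → n → K) (hv : ∀ i, v i ≠ 0) (hAv : ∀ i, A *ᵥ v i = l i • v i) :
    A.charpoly.Separable := by
  rw [charpoly_eq_prod_of_eigenvectors A hl v hv hAv]
  exact separable_prod_X_sub_C_iff.2 hl

theorem exists_eigenvectors_of_separable_charpoly {n : ℕ} {K : Type*} [Field K] [IsAlgClosed K]
    (A : Matrix (Fin n) (Fin n) K) (h : A.charpoly.Separable) :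
    ∃ (l : Fin n → K) (S : Matrix (Fin n) (Fin n) K), Function.Injective l ∧ IsUnit S.det ∧
      A * S = S * diagonal l := by
  classical
  have hcard : A.charpoly.roots.toFinset.card = n := by
    rw [Multiset.toFinset_card_of_nodup (nodup_roots h),
      ← (IsAlgClosed.splits A.charpoly).natDegree_eq_card_roots,
      charpoly_natDegree_eq_dim, Fintype.card_fin]
  let e := A.charpoly.roots.toFinset.equivFinOfCardEq hcard
  have hl : Function.Injective fun i => (e.symm i : K) :=
    Subtype.val_injective.comp e.symm.injective
  have hev : ∀ i, ∃ v : Fin n → K, v ≠ 0 ∧ A *ᵥ v = (e.symm i : K) • v := by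
    intro i
    have hr : A.charpoly.IsRoot (e.symm i : K) :=
      (mem_roots'.1 (Multiset.mem_toFinset.1 (e.symm i).2)).2
    rw [IsRoot, eval_charpoly, ← exists_mulVec_eq_zero_iff] at hr
    obtain ⟨v, hv, hv'⟩ := hr
    refine ⟨v, hv, ?_⟩
    rw [sub_mulVec, sub_eq_zero] at hv'
    rw [← hv']
    ext j
    simp [scalar_apply]
  choose v hv hAv using hev
  have hli : LinearIndependent K v :=
    Module.End.eigenvectors_linearIndependent' (toLin' A) _ hl v fun i =>
      ⟨Module.End.mem_eigenspace_iff.2 (by rw [toLin'_apply, hAv]), hv i⟩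
  refine ⟨_, (of v)ᵀ, hl, ?_, ?_⟩
  · rw [det_transpose, ← isUnit_iff_isUnit_det]
    exact linearIndependent_rows_iff_isUnit.1 hli
  · ext i j
    rw [mul_diagonal]
    exact (congrFun (hAv j) i).trans (mul_comm _ _)

/-- In an eigenbasis of `A`, the matrix `Y` is diagonal because the eigenvalues are distinct, and
the trace conditions are a homogeneous Vandermonde system for its diagonal. -/
theorem eq_zero_of_commute_of_trace_mul_pow_eq_zero {n : ℕ} {K : Type*} [Field K] [IsAlgClosed K]
    {A Y : Matrix (Fin n) (Fin n) K} (h : A.charpoly.Separable) (hAY : A * Y = Y * A)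
    (htr : ∀ k < n, (Y * A ^ k).trace = 0) : Y = 0 := by
  obtain ⟨l, S, hl, hS, hAS⟩ := exists_eigenvectors_of_separable_charpoly A h
  have h1 : S * S⁻¹ = 1 := mul_nonsing_inv _ hS
  have h2 : S⁻¹ * S = 1 := nonsing_inv_mul _ hS
  have hASk : ∀ k : ℕ, A ^ k * S = S * diagonal l ^ k := by
    intro k
    induction k with
    | zero => simp
    | succ k ih => rw [pow_succ, mul_assoc, hAS, ← mul_assoc, ih, mul_assoc, ← pow_succ]
  have hSA : S⁻¹ * A = diagonal l * S⁻¹ := by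
    calc S⁻¹ * A = S⁻¹ * (A * S) * S⁻¹ := by rw [mul_assoc, mul_assoc, h1, mul_one]
      _ = diagonal l * S⁻¹ := by rw [hAS, ← mul_assoc, h2, one_mul]
  set Z := S⁻¹ * Y * S with hZ
  have hYZ : Y = S * Z * S⁻¹ := by
    calc Y = (S * S⁻¹) * Y * (S * S⁻¹) := by rw [h1, one_mul, mul_one]
      _ = _ := by simp only [hZ, mul_assoc]
  have hcomm : diagonal l * Z = Z * diagonal l := by
    calc diagonal l * Z = (diagonal l * S⁻¹) * Y * S := by simp only [hZ, mul_assoc]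
      _ = S⁻¹ * (A * Y) * S := by rw [← hSA]; simp only [mul_assoc]
      _ = S⁻¹ * Y * (A * S) := by rw [hAY]; simp only [mul_assoc]
      _ = Z * diagonal l := by rw [hAS]; simp only [hZ, mul_assoc]
  -- Keep `mul_assoc` from rewriting inside the definition of `Z`.
  clear_value Z
  have hoff : ∀ i j, i ≠ j → Z i j = 0 := by
    intro i j hij
    have := congrFun (congrFun hcomm i) j
    rw [diagonal_mul, mul_diagonal, mul_comm, ← sub_eq_zero, ← mul_sub] at this
    exact (mul_eq_zero.1 this).resolve_right (sub_ne_zero.2 (hl.ne hij))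
  have hdiag : (fun i => Z i i) = 0 := by
    refine eq_zero_of_forall_pow_sum_mul_pow_eq_zero hl fun k => ?_
    have hk := htr k k.2
    have hconj : Z * (S⁻¹ * A ^ (k : ℕ)) * S = Z * diagonal l ^ (k : ℕ) := by
      rw [mul_assoc, mul_assoc, hASk, ← mul_assoc S⁻¹, h2, one_mul]
    rw [hYZ, mul_assoc (S * Z), mul_assoc S, trace_mul_comm, hconj, diagonal_pow] at hk
    simpa [trace, mul_diagonal] using hk
  have hZ0 : Z = 0 := by
    ext i j
    by_cases hij : i = j
    · subst hij
      exact congrFun hdiag i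
    · exact hoff i j hij
  rw [hYZ, hZ0, mul_zero, zero_mul]

theorem separable_charpoly_map_complex {n : ℕ} (A : Matrix (Fin n) (Fin n) ℝ) :
    (A.map (algebraMap ℝ ℂ)).charpoly.Separable ↔ A.charpoly.Separable := by
  rw [charpoly_map, separable_map]

theorem hasNSMP_of_separable_charpoly {n : ℕ} {A : Matrix (Fin n) (Fin n) ℝ}
    (h : A.charpoly.Separable) : HasNSMP A := by
  intro X _ hc ht
  have key : (Xᵀ).map (algebraMap ℝ ℂ) = 0 := by
    refine eq_zero_of_commute_of_trace_mul_pow_eq_zero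
      ((separable_charpoly_map_complex A).2 h) ?_ fun k hk => ?_
    · rw [← Matrix.map_mul, ← Matrix.map_mul, sub_eq_zero.1 hc]
    · have : (A.map (algebraMap ℝ ℂ)) ^ k = (A ^ k).map (algebraMap ℝ ℂ) :=
        (map_pow (algebraMap ℝ ℂ).mapMatrix A k).symm
      rw [this, ← Matrix.map_mul]
      have h2 := congrArg (algebraMap ℝ ℂ) (ht k hk)
      rw [map_zero, AddMonoidHom.map_trace] at h2
      exact h2
  ext i j
  have := congrFun (congrFun key j) i
  simpa using this

/-- On the line from `A` to `B`, the resultant of the characteristic polynomial and its derivative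
is a polynomial in the parameter; it does not vanish at `B`, so it has finitely many zeros. -/
theorem eventually_separable_charpoly {n : ℕ} (A : Matrix (Fin n) (Fin n) ℝ)
    {B : Matrix (Fin n) (Fin n) ℝ} (hB : B.charpoly.Separable) :
    ∀ᶠ t in nhdsWithin (0 : ℝ) {0}ᶜ, (A + t • (B - A)).charpoly.Separable := by
  -- The line `A + t (B - A)` as one matrix over `ℝ[X]`, with `X` in the place of `t`.
  let M : Matrix (Fin n) (Fin n) ℝ[X] := A.map C + (X : ℝ[X]) • (B - A).map C
  have hM : ∀ t : ℝ, M.map (evalRingHom t) = A + t • (B - A) := by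
    intro t
    ext i j
    simp [M]
  let P : (ℝ[X])[X] := M.charpoly
  have hP : ∀ t : ℝ, P.map (evalRingHom t) = (A + t • (B - A)).charpoly := fun t => by
    rw [← hM, charpoly_map]
  have hdeg : ∀ t : ℝ, (A + t • (B - A)).charpoly.natDegree = P.natDegree := fun t => by
    rw [charpoly_natDegree_eq_dim, charpoly_natDegree_eq_dim]
  let r : ℝ[X] := resultant P (derivative P)
  have hr : ∀ t : ℝ, r.eval t ≠ 0 ↔ (A + t • (B - A)).charpoly.Separable := by
    intro t
    rw [separable_def, ← isUnit_resultant_iff_isCoprime (charpoly_monic _), isUnit_iff_ne_zero,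
      natDegree_derivative, hdeg, ← hP, derivative_map, resultant_map_map]
    rw [← natDegree_derivative]
    rfl
  have hr0 : r ≠ 0 := by
    rintro h0
    refine (hr 1).2 ?_ (by rw [h0, eval_zero])
    simpa using hB
  have hfin : {t : ℝ | r.eval t = 0}.Finite := by
    refine (r.roots.toFinset.finite_toSet).subset fun t ht => ?_
    simpa [hr0] using ht
  have : ({t : ℝ | r.eval t = 0} \ {0})ᶜ ∈ nhds (0 : ℝ) :=
    (hfin.subset Set.sdiff_subset).isClosed.isOpen_compl.mem_nhds (by simp)
  filter_upwards [mem_nhdsWithin_of_mem_nhds this, self_mem_nhdsWithin] with t ht ht0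
  rw [← hr]
  exact fun h => ht ⟨h, ht0⟩

end Matrix

/-! ### Realizations with distinct eigenvalues -/

/-- Give all arcs of an orbit of the near-covering permutation the same weight, distinct orbits
getting distinct positive weights, and the exceptional vertex the weight `0`. On an orbit of
length `k` and weight `r` the eigenvalues are `r` times the `k`-th roots of unity, with the
discrete Fourier modes as eigenvectors. Absolute values separate the orbits, so all eigenvalues
are distinct. -/
theorem Digraph.HasNearCover.exists_separable_charpoly {n : ℕ} {D : Digraph (Fin n)}
    (h : D.HasNearCover) :
    ∃ B : Matrix (Fin n) (Fin n) ℝ, (∀ i j, B i j ≠ 0 → D.Adj i j) ∧ B.charpoly.Separable := by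
  classical
  obtain ⟨σ, hσ, huniq⟩ := h
  have hper : ∀ x, x ∈ Function.periodicPts σ := fun x => by
    exact Function.Injective.mem_periodicPts σ.injective x
  -- `rep x` is a base point of the orbit of `x`, `k x` is the length of that orbit, and `s x`
  -- is the position of `x` on it, counted from the base point.
  let rep : Fin n → Fin n := fun x => (Quotient.mk (Equiv.Perm.SameCycle.setoid σ) x).out
  have hrep : ∀ x, σ.SameCycle (rep x) x := fun x =>
    Quotient.exact (Quotient.out_eq (Quotient.mk (Equiv.Perm.SameCycle.setoid σ) x))
  have hrepσ : ∀ x, rep (σ x) = rep x := fun x =>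
    congrArg Quotient.out (Quotient.sound
      (show σ.SameCycle (σ x) x from
        Equiv.Perm.sameCycle_apply_left.2 (Equiv.Perm.SameCycle.refl σ x)))
  let k : Fin n → ℕ := fun x => Function.minimalPeriod σ (rep x)
  have hk : ∀ x, 0 < k x := fun x => Function.minimalPeriod_pos_of_mem_periodicPts (hper _)
  have hs : ∀ x, ∃ s < k x, σ^[s] (rep x) = x := by
    intro x
    obtain ⟨m, hm⟩ := (hrep x).exists_nat_pow_eq
    refine ⟨m % k x, Nat.mod_lt _ (hk x), ?_⟩
    rw [Function.iterate_mod_minimalPeriod_eq, ← Equiv.Perm.coe_pow]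
    exact hm
  choose s hs hsx using hs
  have hsσ : ∀ x, s (σ x) ≡ s x + 1 [MOD k x] := by
    intro x
    have h1 : σ^[s (σ x)] (rep x) = σ^[s x + 1] (rep x) := by
      rw [Function.iterate_succ_apply', hsx, ← hrepσ x, hsx]
    rw [← Function.iterate_mod_minimalPeriod_eq (n := s (σ x)),
      ← Function.iterate_mod_minimalPeriod_eq (n := s x + 1)] at h1
    exact (Function.iterate_eq_iterate_iff_of_lt_minimalPeriod (Nat.mod_lt _ (hk x))
      (Nat.mod_lt _ (hk x))).1 h1
  let r : Fin n → ℝ := fun x => if D.Adj x (σ x) then ((rep x : ℕ) : ℝ) + 1 else 0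
  have hr0 : ∀ x, 0 ≤ r x := fun x => by
    dsimp only [r]; split_ifs <;> positivity
  -- The exceptional vertex is alone in its orbit.
  have hrz : ∀ x, ¬ D.Adj x (σ x) → ∀ y, rep y = rep x → y = x := by
    intro x hx y hy
    have h1 : σ x = x := (hσ x).resolve_left hx
    have h2 : σ.SameCycle x y := (hrep x).symm.trans (hy ▸ hrep y)
    obtain ⟨m, hm⟩ := h2.exists_nat_pow_eq
    rw [← hm, Equiv.Perm.coe_pow, Function.iterate_fixed h1]
  have hrrep : ∀ x y, rep x = rep y → r x = r y := by
    intro x y hxy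
    by_cases hx : D.Adj x (σ x)
    · by_cases hy : D.Adj y (σ y)
      · simp [r, hx, hy, hxy]
      · rw [hrz y hy x hxy]
    · rw [hrz x hx y hxy.symm]
  let ζ : Fin n → ℂ := fun x => Complex.exp (2 * Real.pi * Complex.I / k x)
  have hζ : ∀ x, IsPrimitiveRoot (ζ x) (k x) := fun x =>
    Complex.isPrimitiveRoot_exp _ (hk x).ne'
  have hζn : ∀ x, ‖ζ x‖ = 1 := fun x => (hζ x).norm'_eq_one (hk x).ne'
  have hkrep : ∀ x y, rep x = rep y → k x = k y := fun x y h => by simp only [k, h]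
  have hζrep : ∀ x y, rep x = rep y → ζ x = ζ y := fun x y h => by simp only [ζ, k, h]
  -- Vertex `x`, at position `s x`, indexes the eigenvalue with `ζ x` raised to the power `s x`.
  let l : Fin n → ℂ := fun x => r x * ζ x ^ s x
  have hl : Function.Injective l := by
    intro x y hxy
    have hrxy : r x = r y := by
      have := congrArg norm hxy
      simpa [l, hζn, abs_of_nonneg, hr0] using this
    by_cases hx : D.Adj x (σ x)
    · have hrx : 0 < r x := by simp only [r, hx, if_true]; positivity
      have hy : D.Adj y (σ y) := by
        by_contra hy
        rw [hrxy] at hrx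
        simp [r, hy] at hrx
      have hxyrep : rep x = rep y := by
        simpa [r, hx, hy, Fin.ext_iff] using hrxy
      have h1 : ζ x ^ s x = ζ x ^ s y := by
        have h2 : (r x : ℂ) * ζ x ^ s x = r x * ζ x ^ s y := by
          have := hxy
          simp only [l] at this
          rwa [← hrxy, ← hζrep x y hxyrep] at this
        exact mul_left_cancel₀ (by exact_mod_cast hrx.ne') h2
      have h3 := (hζ x).pow_inj (hs x) (hkrep x y hxyrep ▸ hs y) h1
      rw [← hsx x, ← hsx y, h3, hxyrep]
    · refine huniq x y hx fun hy => hx ?_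
      exfalso
      have : r y ≠ 0 := by simp only [r, hy, if_true]; positivity
      apply this
      rw [← hrxy]
      simp [r, hx]
  let B : Matrix (Fin n) (Fin n) ℝ := Matrix.of fun x y => if σ x = y then r x else 0
  -- The Fourier mode of frequency `s x`, supported on the orbit of `x`.
  let v : Fin n → Fin n → ℂ := fun x y => if rep y = rep x then ζ x ^ (s x * s y) else 0
  refine ⟨B, ?_, ?_⟩
  · intro x y hxy
    by_cases h1 : σ x = y
    · subst h1
      by_contra h2
      exact hxy (by simp [B, r, h2])
    · simp [B, h1] at hxy
  · rw [← Matrix.separable_charpoly_map_complex]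
    refine Matrix.separable_charpoly_of_eigenvectors _ hl v ?_ ?_
    · intro x hx
      have := congrFun hx x
      simp only [v, if_true, Pi.zero_apply] at this
      exact pow_ne_zero _ ((hζ x).ne_zero (hk x).ne') this
    · intro x
      ext y
      have h1 : (B.map (algebraMap ℝ ℂ)).mulVec (v x) y = r y * v x (σ y) := by
        simp [Matrix.mulVec, dotProduct, B, apply_ite, ite_mul]
      rw [h1, Pi.smul_apply, smul_eq_mul]
      by_cases hxy : rep y = rep x
      · have h2 : ζ x ^ (s x * s (σ y)) = ζ x ^ (s x * (s y + 1)) := by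
          have h3 := (hsσ y).mul_left (s x)
          rw [hkrep y x hxy] at h3
          rw [← pow_mod_orderOf, ← (hζ x).eq_orderOf, h3, (hζ x).eq_orderOf, pow_mod_orderOf]
        simp only [v, l, hrepσ, hxy, if_true, h2, hrrep y x hxy]
        ring
      · simp [v, hrepσ, hxy]

/-- The signs of a realization survive small perturbations within the zero pattern, and almost all
matrices on the line towards the weighted permutation matrix have distinct eigenvalues. -/
theorem SignPattern.exists_separable_charpoly_of_hasNearCover {n : ℕ} {𝒜 : SignPattern n}
    (h : 𝒜.digraph.HasNearCover) : ∃ A ∈ 𝒜.qualitativeClass, A.charpoly.Separable := by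
  obtain ⟨B, hB, hsep⟩ := h.exists_separable_charpoly
  -- The realization of `𝒜` with entries in `{1, -1, 0}`.
  let A : Matrix (Fin n) (Fin n) ℝ := Matrix.of fun i j => ((𝒜 i j : ℤ) : ℝ)
  have hsign : ∀ᶠ t in nhdsWithin (0 : ℝ) {0}ᶜ, ∀ i j,
      SignType.sign ((A + t • (B - A)) i j) = 𝒜 i j := by
    refine Filter.eventually_all.2 fun i => Filter.eventually_all.2 fun j => ?_
    apply eventually_nhdsWithin_of_eventually_nhds
    have hcont : Continuous fun t : ℝ => (A + t • (B - A)) i j := by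
      simp only [Matrix.add_apply, Matrix.smul_apply]
      fun_prop
    rcases hA : 𝒜 i j with _ | _ | _
    · have hB0 : B i j = 0 := by
        by_contra h0
        exact hB i j h0 hA
      refine Filter.Eventually.of_forall fun t => ?_
      simp [A, hA, hB0]
    · have : (A + (0 : ℝ) • (B - A)) i j < 0 := by simp [A, hA]
      filter_upwards [hcont.continuousAt.eventually_lt continuousAt_const this] with t ht
      exact sign_neg ht
    · have : 0 < (A + (0 : ℝ) • (B - A)) i j := by simp [A, hA]
      filter_upwards [continuousAt_const.eventually_lt hcont.continuousAt this] with t ht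
      exact sign_pos ht
  obtain ⟨t, ht1, ht2⟩ := (hsign.and (Matrix.eventually_separable_charpoly A hsep)).exists
  exact ⟨_, ht1, ht2⟩

/-! ### Perturbation of matrices with the nSMP -/

/-- If `0` is a multiple eigenvalue of `f` then `p(0)` is one of `p(f)`: the generalized
eigenspace of `f` at `0` lies in that of `p(f)` at `p(0)`. -/
theorem LinearMap.not_separable_charpoly_aeval {K V : Type*} [Field K] [AddCommGroup V]
    [Module K V] [FiniteDimensional K V] {f : Module.End K V} (hf : X ^ 2 ∣ f.charpoly)
    (p : K[X]) : ¬ (aeval f p).charpoly.Separable := by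
  intro hsep
  have h1 : 2 ≤ f.charpoly.rootMultiplicity 0 := by
    rw [le_rootMultiplicity_iff f.charpoly_monic.ne_zero]
    simpa using hf
  have h2 : f.maxGenEigenspace 0 ≤ (aeval f p).maxGenEigenspace (p.eval 0) := by
    intro v hv
    rw [Module.End.mem_maxGenEigenspace] at hv ⊢
    obtain ⟨k, hk⟩ := hv
    refine ⟨k, ?_⟩
    obtain ⟨q, hq⟩ : X ∣ p - C (p.eval 0) := by
      rw [X_dvd_iff]
      simp [coeff_zero_eq_eval_zero]
    have hcomm : Commute (aeval f q) f := by
      simpa using (Commute.all q X).map (aeval f)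
    have h3 : aeval f p - p.eval 0 • (1 : Module.End K V) = aeval f q * f := by
      have := congrArg (aeval f) hq
      rw [map_sub, map_mul, aeval_X, aeval_C, Algebra.algebraMap_eq_smul_one] at this
      rw [this, hcomm.eq]
    rw [h3, hcomm.mul_pow, Module.End.mul_apply]
    rw [zero_smul, sub_zero] at hk
    rw [hk, map_zero]
  have h4 := Submodule.finrank_mono h2
  rw [LinearMap.finrank_maxGenEigenspace_eq, LinearMap.finrank_maxGenEigenspace_eq] at h4
  have h5 := rootMultiplicity_le_one_of_separable hsep (p.eval 0)
  omega

theorem Matrix.not_separable_charpoly_aeval {n K : Type*} [Fintype n] [DecidableEq n] [Field K]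
    {N : Matrix n n K} (hN : X ^ 2 ∣ N.charpoly) (p : K[X]) :
    ¬ (aeval N p).charpoly.Separable := by
  have h1 := LinearMap.not_separable_charpoly_aeval (f := N.toLin')
    (by rwa [charpoly_toLin']) p
  have h2 : aeval N.toLin' p = (aeval N p).toLin' :=
    aeval_algHom_apply (toLinAlgEquiv' : Matrix n n K ≃ₐ[K] _).toAlgHom N p
  rwa [h2, charpoly_toLin'] at h1

/-- If the range of `P`, the commutators with `a` and the powers of `a` below `n` together span
the algebra, then every element near `a` is conjugate to a polynomial in some `a + P b`. The
hypothesis says that `(b, l, c) ↦ exp(l) (N + ∑ c k N ^ k) exp(-l)`, `N = a + P b`, is a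
submersion at `0`. -/
theorem eventually_exists_conj_aeval {𝔸 : Type*} [NormedRing 𝔸] [NormedAlgebra ℝ 𝔸]
    [FiniteDimensional ℝ 𝔸] (a : 𝔸) (P : 𝔸 →ₗ[ℝ] 𝔸) (n : ℕ)
    (hsurj : ∀ x : 𝔸, ∃ (b l : 𝔸) (c : Fin n → ℝ),
      P b + (l * a - a * l) + ∑ k, c k • a ^ (k : ℕ) = x) :
    ∀ᶠ y in nhds a, ∃ (u : 𝔸ˣ) (b : 𝔸) (p : ℝ[X]),
      y = (u : 𝔸) * aeval (a + P b) p * ((u⁻¹ : 𝔸ˣ) : 𝔸) := by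
  have : CompleteSpace 𝔸 := FiniteDimensional.complete ℝ 𝔸
  let P' : 𝔸 →L[ℝ] 𝔸 := LinearMap.toContinuousLinearMap P
  let Φ : 𝔸 × 𝔸 × (Fin n → ℝ) → 𝔸 := fun z =>
    NormedSpace.exp z.2.1 * ((a + P' z.1) + ∑ k, z.2.2 k • (a + P' z.1) ^ (k : ℕ)) *
      NormedSpace.exp (-z.2.1)
  have hexp : ContDiff ℝ 1 (NormedSpace.exp : 𝔸 → 𝔸) :=
    contDiff_iff_contDiffAt.2 fun x => (NormedSpace.exp_analytic (𝕂 := ℝ) x).contDiffAt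
  have hΦ : ContDiff ℝ 1 Φ := by
    dsimp only [Φ]
    fun_prop
  have hΦ0 : Φ 0 = a := by simp [Φ]
  have hstrict : HasStrictFDerivAt Φ (fderiv ℝ Φ 0) 0 :=
    hΦ.contDiffAt.hasStrictFDerivAt one_ne_zero
  -- The derivative in a direction `d` can be read off from the curve `t ↦ Φ (t d)`.
  have hdir : ∀ d x, HasDerivAt (fun t : ℝ => Φ (t • d)) x 0 → fderiv ℝ Φ 0 d = x := by
    intro d x hx
    have h1 : HasDerivAt (fun t : ℝ => t • d) d 0 := by
      simpa using (hasDerivAt_id (0 : ℝ)).smul_const d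
    have h2 : HasFDerivAt Φ (fderiv ℝ Φ 0) ((0 : ℝ) • d) := by
      rw [zero_smul]; exact hstrict.hasFDerivAt
    have h3 : HasDerivAt (fun t : ℝ => Φ (t • d)) (fderiv ℝ Φ 0 d) 0 :=
      HasFDerivAt.comp_hasDerivAt (f := fun t : ℝ => t • d) (0 : ℝ) h2 h1
    exact h3.unique hx
  have hb : ∀ b, fderiv ℝ Φ 0 (b, 0, 0) = P b := by
    intro b
    apply hdir
    have h1 : HasDerivAt (fun t : ℝ => a + t • P b) (P b) 0 := by
      simpa using ((hasDerivAt_id (0 : ℝ)).smul_const (P b)).const_add a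
    refine h1.congr_of_eventuallyEq (Filter.Eventually.of_forall fun t => ?_)
    simp [Φ, P']
  have hl : ∀ l, fderiv ℝ Φ 0 (0, l, 0) = l * a - a * l := by
    intro l
    apply hdir
    have h1 : HasDerivAt (fun t : ℝ => NormedSpace.exp (t • l)) l 0 := by
      simpa using hasDerivAt_exp_smul_const (𝕂 := ℝ) l (0 : ℝ)
    have h2 : HasDerivAt (fun t : ℝ => NormedSpace.exp (t • (-l))) (-l) 0 := by
      simpa using hasDerivAt_exp_smul_const (𝕂 := ℝ) (-l) (0 : ℝ)
    have h3 := (h1.mul_const a).mul h2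
    simp only [zero_smul, NormedSpace.exp_zero, mul_one, one_mul, mul_neg, ← sub_eq_add_neg] at h3
    refine h3.congr_of_eventuallyEq (Filter.Eventually.of_forall fun t => ?_)
    simp [Φ]
  have hc : ∀ c, fderiv ℝ Φ 0 (0, 0, c) = ∑ k, c k • a ^ (k : ℕ) := by
    intro c
    apply hdir
    have h1 : HasDerivAt (fun t : ℝ => a + t • ∑ k, c k • a ^ (k : ℕ))
        (∑ k, c k • a ^ (k : ℕ)) 0 := by
      simpa using ((hasDerivAt_id (0 : ℝ)).smul_const (∑ k, c k • a ^ (k : ℕ))).const_add a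
    refine h1.congr_of_eventuallyEq (Filter.Eventually.of_forall fun t => ?_)
    simp [Φ, Finset.smul_sum, mul_smul]
  have hrange : (fderiv ℝ Φ 0).range = ⊤ := by
    rw [LinearMap.range_eq_top]
    intro x
    obtain ⟨b, l, c, rfl⟩ := hsurj x
    refine ⟨(b, l, c), ?_⟩
    have : ((b, l, c) : 𝔸 × 𝔸 × (Fin n → ℝ)) = (b, 0, 0) + (0, l, 0) + (0, 0, c) := by simp
    rw [this, map_add, map_add]
    exact congrArg₂ _ (congrArg₂ _ (hb b) (hl l)) (hc c)
  have hopen := hstrict.map_nhds_eq_of_surj hrange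
  rw [hΦ0] at hopen
  rw [← hopen, Filter.eventually_map]
  refine Filter.Eventually.of_forall fun z => ?_
  let _ : NormedAlgebra ℚ 𝔸 := NormedAlgebra.restrictScalars ℚ ℝ 𝔸
  refine ⟨⟨NormedSpace.exp z.2.1, NormedSpace.exp (-z.2.1), ?_, ?_⟩, z.1,
    X + ∑ k, C (z.2.2 k) * X ^ (k : ℕ), ?_⟩
  · rw [← NormedSpace.exp_add_of_commute (Commute.neg_right (Commute.refl _))]; simp
  · rw [← NormedSpace.exp_add_of_commute (Commute.neg_left (Commute.refl _))]; simp
  · simp [Φ, P', Algebra.smul_def]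

/-- The dual form of the nSMP: the matrices supported on the nonzero positions of `A`, the
commutators with `A` and the powers of `A` span all matrices. For the pairing `tr (Xᵀ M)`, the
conditions on `X` in `HasNSMP` say that `X` is orthogonal to these three families. -/
theorem HasNSMP.exists_decomposition {n : ℕ} {A : Matrix (Fin n) (Fin n) ℝ} (hA : HasNSMP A)
    (P : Matrix (Fin n) (Fin n) ℝ →ₗ[ℝ] Matrix (Fin n) (Fin n) ℝ)
    (hP : ∀ i j, A i j ≠ 0 → P (Matrix.single i j 1) = Matrix.single i j 1)
    (M : Matrix (Fin n) (Fin n) ℝ) :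
    ∃ (b l : Matrix (Fin n) (Fin n) ℝ) (c : Fin n → ℝ),
      P b + (l * A - A * l) + ∑ k, c k • A ^ (k : ℕ) = M := by
  let T : (Matrix (Fin n) (Fin n) ℝ × Matrix (Fin n) (Fin n) ℝ × (Fin n → ℝ)) →ₗ[ℝ]
      Matrix (Fin n) (Fin n) ℝ :=
    P.coprod ((LinearMap.mulRight ℝ A - LinearMap.mulLeft ℝ A).coprod
      (Fintype.linearCombination ℝ fun k : Fin n => A ^ (k : ℕ)))
  have hT : ∀ b l c, T (b, l, c) = P b + (l * A - A * l) + ∑ k, c k • A ^ (k : ℕ) := by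
    intro b l c
    simp [T, Fintype.linearCombination_apply, add_assoc]
  suffices h : LinearMap.range T = ⊤ by
    obtain ⟨⟨b, l, c⟩, h⟩ := LinearMap.range_eq_top.1 h M
    exact ⟨b, l, c, by rw [← hT, h]⟩
  by_contra hne
  obtain ⟨f, hf0, hf⟩ := Submodule.exists_le_ker_of_lt_top _ (lt_top_iff_ne_top.2 hne)
  have hfT : ∀ b l c, f (T (b, l, c)) = 0 := fun b l c => hf (LinearMap.mem_range_self T _)
  -- The matrix representing `f` for the pairing `(Z, M) ↦ tr (Zᵀ M)`.
  let Z : Matrix (Fin n) (Fin n) ℝ := Matrix.of fun i j => f (Matrix.single i j 1)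
  have hfZ : ∀ M, f M = (Zᵀ * M).trace := by
    intro M
    conv_lhs => rw [Matrix.matrix_eq_sum_single M]
    simp only [map_sum, Matrix.trace, Matrix.diag, Matrix.mul_apply]
    rw [Finset.sum_comm]
    refine Finset.sum_congr rfl fun j _ => Finset.sum_congr rfl fun i _ => ?_
    have : Matrix.single i j (M i j) = M i j • Matrix.single i j (1 : ℝ) := by simp
    rw [this, map_smul, smul_eq_mul, mul_comm]
    rfl
  have hZ : Z = 0 := by
    refine hA Z ?_ ?_ fun k hk => ?_
    · ext i j
      rw [Matrix.hadamard_apply, Matrix.zero_apply, mul_eq_zero]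
      by_contra! h
      refine h.2 ?_
      have := hfT (Matrix.single i j 1) 0 0
      rw [hT] at this
      rw [← show f (Matrix.single i j 1) = Z i j from rfl]
      simpa [hP i j h.1] using this
    · refine Matrix.ext_iff_trace_mul_right.2 fun l => ?_
      have h1 : (Zᵀ * (l * A)).trace - (Zᵀ * (A * l)).trace = 0 := by
        have := hfT 0 l 0
        rw [hT] at this
        simpa [hfZ, mul_sub] using this
      have h2 : (Zᵀ * (l * A)).trace = (A * Zᵀ * l).trace := by
        rw [← mul_assoc, Matrix.trace_mul_comm, ← mul_assoc]
      rw [sub_mul, Matrix.trace_sub, zero_mul, Matrix.trace_zero, ← h2, mul_assoc, h1]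
    · have := hfT 0 0 (Pi.single ⟨k, hk⟩ 1)
      rw [hT] at this
      simpa [Pi.single_apply, hfZ] using this
  exact hf0 (LinearMap.ext fun M => by rw [hfZ, hZ]; simp)

/-- Matrices with distinct eigenvalues are dense. -/
theorem Matrix.frequently_separable_charpoly {n : ℕ} (A : Matrix (Fin n) (Fin n) ℝ) :
    ∃ᶠ M in nhds A, M.charpoly.Separable := by
  have hB : (Matrix.diagonal fun i : Fin n => ((i : ℕ) : ℝ)).charpoly.Separable := by
    rw [Matrix.charpoly_diagonal]
    exact separable_prod_X_sub_C_iff.2 (Nat.cast_injective.comp Fin.val_injective)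
  have hcont : Continuous fun t : ℝ =>
      A + t • ((Matrix.diagonal fun i : Fin n => ((i : ℕ) : ℝ)) - A) := by fun_prop
  have htend := (hcont.tendsto 0).mono_left (nhdsWithin_le_nhds (s := {0}ᶜ))
  rw [zero_smul, add_zero] at htend
  exact htend.frequently (Matrix.eventually_separable_charpoly A hB).frequently

/-- A matrix with distinct eigenvalues arbitrarily close to `A` is conjugate to a polynomial in a
matrix `N` that vanishes where `A` does, and then `0` cannot be a multiple eigenvalue of `N`. -/
theorem HasNSMP.exists_not_X_sq_dvd_charpoly {n : ℕ} {A : Matrix (Fin n) (Fin n) ℝ}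
    (hA : HasNSMP A) :
    ∃ N : Matrix (Fin n) (Fin n) ℝ, (∀ i j, A i j = 0 → N i j = 0) ∧ ¬ X ^ 2 ∣ N.charpoly := by
  -- Any algebra norm serves; this one induces the entrywise topology definitionally.
  let _ : NormedRing (Matrix (Fin n) (Fin n) ℝ) := Matrix.linftyOpNormedRing
  let _ : NormedAlgebra ℝ (Matrix (Fin n) (Fin n) ℝ) := Matrix.linftyOpNormedAlgebra
  -- The projection onto the matrices supported on the nonzero positions of `A`.
  let P : Matrix (Fin n) (Fin n) ℝ →ₗ[ℝ] Matrix (Fin n) (Fin n) ℝ :=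
    { toFun := fun B => Matrix.of fun i j => if A i j = 0 then 0 else B i j
      map_add' := fun B C => by ext i j; by_cases h : A i j = 0 <;> simp [h]
      map_smul' := fun c B => by ext i j; by_cases h : A i j = 0 <;> simp [h] }
  have hP : ∀ i j, A i j ≠ 0 → P (Matrix.single i j 1) = Matrix.single i j 1 := by
    intro i j hij
    ext i' j'
    by_cases h : i = i' ∧ j = j'
    · obtain ⟨rfl, rfl⟩ := h
      simp [P, hij]
    · simp [P, h]
  have hev := eventually_exists_conj_aeval A P n (hA.exists_decomposition P hP)
  obtain ⟨M, hM, u, b, p, rfl⟩ :=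
    ((Matrix.frequently_separable_charpoly A).and_eventually hev).exists
  refine ⟨A + P b, fun i j hij => by simp [P, hij], fun hdvd => ?_⟩
  rw [Matrix.coe_units_inv, Matrix.charpoly_units_conj] at hM
  exact Matrix.not_separable_charpoly_aeval hdvd p hM

end

/-! ### Sign patterns that allow the nSMP -/

theorem mainTheorem3 (n : ℕ) (𝒜 : SignPattern n) :
    𝒜.Allows HasNSMP ↔ (n : ℤ) - 1 ≤ (𝒜.digraph.maxCompositeCycleLength : ℤ) := by
  rw [← Digraph.hasNearCover_iff]
  constructor
  · rintro ⟨A, hA, hsmp⟩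
    obtain ⟨N, hN, hdvd⟩ := hsmp.exists_not_X_sq_dvd_charpoly
    obtain ⟨σ, hσ, huniq⟩ := N.exists_perm_of_not_X_sq_dvd_charpoly hdvd
    have hadj : ∀ i j, N i j ≠ 0 → 𝒜.digraph.Adj i j := by
      intro i j hij h
      refine hij (hN i j ?_)
      rw [← sign_eq_zero_iff, hA i j, h]
    exact ⟨σ, fun i => (hσ i).imp_left (hadj _ _), fun i j hi hj =>
      huniq i j (not_not.1 (mt (hadj _ _) hi)) (not_not.1 (mt (hadj _ _) hj))⟩
  · intro h
    obtain ⟨A, hA, hsep⟩ := SignPattern.exists_separable_charpoly_of_hasNearCover h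
    exact ⟨A, hA, Matrix.hasNSMP_of_separable_charpoly hsep⟩
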